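/- **Theorem 3.1.** Let $X$ be a complex Banach space with a (finite or countably infinite) unconditional Schauder basis $\{e_i\}_{i\in I}$ that is $1$-unconditional, i.e. $\|\sum_{i\in F}\theta_i a_i e_i\| = \|\sum_{i\in F} a_i e_i\|$ for all finite $F\subset I$, all $a_i\in\mathbb C$ and all $\theta_i\in\mathbb C$ with $|\theta_i|=1$. Assume that $X$ is strictly monotone, i.e. $\|x+y\|>\|x\|$ whenever all coordinates of $x$ and $y$ are real and non-negative and $y\neq 0$, and that $X$ is not isometrically isomorphic to $\ell_2$. Let $P:X\to X$ be a bounded linear projection with $\|P\|=1$, and let $Y=PX$. A bounded operator $T$ on a complex Banach space $Z$ is called hermitian if $f(Tz)\in\mathbb R$ for all $z\in Z$ and all $f\in Z^*$ with $\|f\|=1$ and $f(z)=\|z\|$. An element $z\in Z$ is called hermitian if there is a hermitian projection from $Z$ onto $\operatorname{span}\{z\}$. The Hilbert components of $Z$ are the linear subspaces of $Z$ that are maximal among the linear subspaces consisting of hermitian elements. Then the Hilbert components of $Y$ are disjointly supported as elements of $X$: if $H\neq K$ are Hilbert components of $Y$, $x\in H$ and $y\in K$, then $\operatorname{supp}x\cap\operatorname{supp}y=\varnothing$,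 where $\operatorname{supp}x=\{i\in I : x_i\neq 0\}$ for $x=\sum_{i} x_i e_i$. -/

import Mathlib

namespace BanachSeq

section Hermitian

variable {Z : Type*} [NormedAddCommGroup Z] [NormedSpace ℂ Z]

/-- `f` is a norming functional for `z`: `‖f‖ = 1` and `f z = ‖z‖`. -/
def IsNorming (f : StrongDual ℂ Z) (z : Z) : Prop :=
  ‖f‖ = 1 ∧ f z = (‖z‖ : ℂ)

/-- A bounded operator on a complex normed space is hermitian if its (spatial) numerical range
is real: `f (T z) ∈ ℝ` whenever `f` is norming for `z`. -/
def IsHermitianOperator (T : Z →L[ℂ] Z) : Prop :=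
  ∀ (z : Z) (f : StrongDual ℂ Z), IsNorming f z → (f (T z)).im = 0

/-- `x` is a hermitian element if there is a hermitian projection onto `span {x}`. -/
def IsHermitianElement (x : Z) : Prop :=
  ∃ Q : Z →L[ℂ] Z, IsIdempotentElem Q ∧
    LinearMap.range (Q : Z →ₗ[ℂ] Z) = Submodule.span ℂ {x} ∧ IsHermitianOperator Q

/-- A Hilbert component of `Z` is a linear subspace of `Z` that is maximal among the linear
subspaces consisting of hermitian elements of `Z`. -/
def IsHilbertComponent (H : Submodule ℂ Z) : Prop :=
  Maximal (fun S : Submodule ℂ Z => ∀ x ∈ S, IsHermitianElement x) H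

end Hermitian

section Basis

variable {I : Type*} {X : Type*} [NormedAddCommGroup X] [NormedSpace ℂ X]

/-- The basis is `1`-unconditional (in the complex sense): multiplying the coefficients of a
finite linear combination by complex numbers of modulus one does not change the norm. -/
def IsOneUnconditional (e : UnconditionalSchauderBasis I ℂ X) : Prop :=
  ∀ (s : Finset I) (a θ : I → ℂ), (∀ i ∈ s, ‖θ i‖ = 1) →
    ‖∑ i ∈ s, (θ i * a i) • e i‖ = ‖∑ i ∈ s, a i • e i‖

/-- `x ≥ 0`: all coordinates of `x` are non-negative real numbers. -/
def IsNonnegVector (e : UnconditionalSchauderBasis I ℂ X) (x : X) : Prop :=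
  ∀ i, 0 ≤ (e.coord i x).re ∧ (e.coord i x).im = 0

/-- Strict monotonicity: `‖x + y‖ > ‖x‖` for all `x, y ≥ 0` with `y ≠ 0`. -/
def IsStrictlyMonotone (e : UnconditionalSchauderBasis I ℂ X) : Prop :=
  ∀ x y : X, IsNonnegVector e x → IsNonnegVector e y → y ≠ 0 → ‖x‖ < ‖x + y‖

/-- The support of `x` with respect to the basis. -/
def supp (e : UnconditionalSchauderBasis I ℂ X) (x : X) : Set I :=
  {i | e.coord i x ≠ 0}

end Basis

end BanachSeq

/-!
Two facts carry the proof.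

**Hilbert components are orthogonality classes.** In a complex normed space `Z`, a nonzero hermitian
element `u` has a hermitian projection `f ⊗ u : z ↦ f z • u` with `f u = 1`. The operators
`exp (itT)`, for `T` a hermitian projection, are isometries
(`IsHermitianOperator.norm_rotation`). Conjugating by them shows that, for hermitian `S`, both
`i (TS - ST)` and `TS + ST - 2 TST` are hermitian. For two hermitian projections `f ⊗ u` and
`g ⊗ v` with `f v ≠ 0`, real combinations of these operators contain the rank-one operator attached
to every combination of `u` and `v`, just as for orthogonal projections in a Hilbert space
(`IsHermitianPair.exists_isHermitianOperator_combination`). Call `v` orthogonal to `u` if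
`f v = 0`; among hermitian elements this relation is symmetric. Then a hermitian element which is
not orthogonal to some element of a Hilbert component belongs to that component
(`IsHilbertComponent.mem_of_apply_ne_zero`), and two components with a common nonzero element
coincide (`IsHilbertComponent.eq_of_mem`).

**Coordinates restrict to hermitian functionals on the range of `P`.** By `1`-unconditionality the
coordinate projection `x ↦ x_i e_i` is hermitian on `X`, hence its compression `y ↦ y_i P e_i` is
hermitian on the range of `P`. If the `i`-th coordinate does not vanish on the range, then
`P e_i ≠ 0`: otherwise `P` would map `y - y_i e_i`, which by strict monotonicity is strictly shorter
than `y`, to `y`. So `P e_i` is a hermitian element whose functional is a multiple of the `i`-th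
coordinate (`exists_isHermitianPair_coord`).

If now `i` lies in the supports of `x ∈ H` and of `y ∈ K`, then the nonzero element `P e_i` is
orthogonal to neither, so it belongs to both components, and `H = K`.
-/

namespace BanachSeq

open Filter Topology
open scoped ComplexConjugate

/-! ### Hermitian operators -/

section Operators

variable {Z : Type*} [NormedAddCommGroup Z] [NormedSpace ℂ Z]

namespace IsHermitianOperator

variable {S T : Z →L[ℂ] Z}

lemma add (hS : IsHermitianOperator S) (hT : IsHermitianOperator T) :
    IsHermitianOperator (S + T) := fun z f hf => by
  simp [hS z f hf, hT z f hf]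

lemma sub (hS : IsHermitianOperator S) (hT : IsHermitianOperator T) :
    IsHermitianOperator (S - T) := fun z f hf => by
  simp [hS z f hf, hT z f hf]

lemma real_smul (hT : IsHermitianOperator T) (r : ℝ) :
    IsHermitianOperator ((r : ℂ) • T) := fun z f hf => by
  simp [hT z f hf]

/-- The infinitesimal form of `exp (itT)` being an isometry: a norming functional `f` of `z` gives
`Re f (z + itTz) = ‖z‖`, for either sign of `t`. -/
lemma norm_le_norm_add (hT : IsHermitianOperator T) (t : ℝ) (z : Z) :
    ‖z‖ ≤ ‖z + (t * Complex.I : ℂ) • T z‖ := by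
  by_cases hz : z = 0
  · simp [hz]
  obtain ⟨f, hf1, hfz⟩ := exists_dual_vector ℂ z (norm_ne_zero_iff.mpr hz)
  have him := hT z f ⟨hf1, hfz⟩
  calc ‖z‖ = (f (z + (t * Complex.I : ℂ) • T z)).re := by simp [hfz, him]
    _ ≤ ‖f (z + (t * Complex.I : ℂ) • T z)‖ := Complex.re_le_norm _
    _ ≤ ‖z + (t * Complex.I : ℂ) • T z‖ := by
        simpa only [hf1, one_mul] using f.le_opNorm (z + (t * Complex.I : ℂ) • T z)

/-- Here `exp (itN) = 1 + itN`, so these operators are bounded uniformly in `t`. -/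
lemma eq_zero_of_mul_self_eq_zero (hT : IsHermitianOperator T) (h : T * T = 0) : T = 0 := by
  ext z
  have hTT : T (T z) = 0 := by simpa using congr($h z)
  have key : ∀ t : ℝ, ‖z + (t * Complex.I : ℂ) • T z‖ ≤ ‖z‖ := fun t => by
    have := hT.norm_le_norm_add (-t) (z + (t * Complex.I : ℂ) • T z)
    simpa [hTT] using this
  have key2 : ∀ t : ℝ, |t| * ‖T z‖ ≤ 2 * ‖z‖ := fun t => by
    have h1 := norm_sub_le (z + (t * Complex.I : ℂ) • T z) z
    rw [add_sub_cancel_left, norm_smul] at h1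
    simp only [norm_mul, Complex.norm_real, Complex.norm_I, mul_one, Real.norm_eq_abs] at h1
    linarith [key t]
  by_contra hne
  have hpos : 0 < ‖T z‖ := norm_pos_iff.mpr hne
  have h2 := key2 ((2 * ‖z‖ + 1) / ‖T z‖)
  rw [abs_of_nonneg (by positivity), div_mul_cancel₀ _ hpos.ne'] at h2
  linarith

/-- The rotations `1 + (λ - 1) T = exp (itT)`, `λ = exp (it)`, attached to a hermitian projection
`T` are isometries: the norm along an orbit changes by `O (h ^ 2)` between the parameters `t`
and `t + h`, so its derivative vanishes. -/
lemma norm_rotation (hT : IsHermitianOperator T) (hTT : IsIdempotentElem T) {l : ℂ}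
    (hl : ‖l‖ = 1) (z : Z) : ‖z + (l - 1) • T z‖ = ‖z‖ := by
  have hT2 : T (T z) = T z := by simpa using congr($hTT z)
  let w : ℝ → Z := fun t => z + (Complex.exp (t * Complex.I) - 1) • T z
  have hTw : ∀ t, T (w t) = Complex.exp (t * Complex.I) • T z := fun t => by
    simp [w, hT2, sub_smul]
  have hexp : ∀ t : ℝ, ‖Complex.exp (t * Complex.I)‖ = 1 := Complex.norm_exp_ofReal_mul_I
  have lower : ∀ t h : ℝ, |h| ≤ 1 → ‖w t‖ - ‖T z‖ * h ^ 2 ≤ ‖w (t + h)‖ := fun t h hh => by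
    have h1 := hT.norm_le_norm_add h (w t)
    have h2 : w (t + h) = (w t + (h * Complex.I : ℂ) • T (w t)) +
        (Complex.exp (t * Complex.I) *
          (Complex.exp (h * Complex.I) - 1 - h * Complex.I)) • T z := by
      rw [hTw]
      simp only [w, Complex.ofReal_add, add_mul, Complex.exp_add]
      module
    have h3 : ‖(Complex.exp (t * Complex.I) *
          (Complex.exp (h * Complex.I) - 1 - h * Complex.I)) • T z‖ ≤ ‖T z‖ * h ^ 2 := by
      rw [norm_smul, norm_mul, hexp, one_mul, mul_comm]
      gcongr
      have := Complex.norm_exp_sub_one_sub_id_le (x := h * Complex.I) (by simpa using hh)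
      simpa using this
    rw [h2]
    have h4 := norm_sub_le_norm_add (w t + (h * Complex.I : ℂ) • T (w t))
      ((Complex.exp (t * Complex.I) *
          (Complex.exp (h * Complex.I) - 1 - h * Complex.I)) • T z)
    linarith
  have hder : ∀ t, HasDerivAt (fun t => ‖w t‖) 0 t := fun t => by
    rw [hasDerivAt_iff_isLittleO_nhds_zero]
    refine Asymptotics.IsBigO.trans_isLittleO (g := fun h : ℝ => h ^ 2) ?_
      (by simpa using Asymptotics.isLittleO_pow_id (𝕜 := ℝ) one_lt_two)
    refine Asymptotics.IsBigO.of_bound ‖T z‖ ?_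
    filter_upwards [Metric.closedBall_mem_nhds (0 : ℝ) one_pos] with h hh
    have hh' : |h| ≤ 1 := by simpa using hh
    have h1 := lower t h hh'
    have h2 := lower (t + h) (-h) (by simpa using hh')
    simp only [add_neg_cancel_right, even_two, Even.neg_pow] at h2
    simp only [smul_zero, sub_zero, Real.norm_eq_abs, abs_pow, sq_abs]
    rw [abs_le]
    constructor <;> linarith
  have hconst := is_const_of_deriv_eq_zero (fun t => (hder t).differentiableAt)
    (fun t => (hder t).deriv) (Complex.arg l) 0
  have hl' : Complex.exp (Complex.arg l * Complex.I) = l := by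
    simpa [hl] using Complex.norm_mul_exp_arg_mul_I l
  simpa [w, hl'] using hconst

/-- An operator all of whose rotations `1 + (λ - 1) T` are contractive is hermitian. -/
lemma of_norm_rotation_le
    (h : ∀ l : ℂ, ‖l‖ = 1 → ∀ z, ‖z + (l - 1) • T z‖ ≤ ‖z‖) : IsHermitianOperator T := by
  intro z f hf
  -- For `a = f (T z)`, pick the rotation aligning `l * a` with `‖z‖ - a`, so that
  -- `|‖z‖ - a| + |a| ≤ ‖z‖`; this forces `a` to be real.
  set a := f (T z) with ha
  set b : ℂ := ‖z‖ - a with hb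
  have key : ‖b‖ + ‖a‖ ≤ ‖z‖ := by
    obtain ⟨l, hl, hlab⟩ : ∃ l : ℂ, ‖l‖ = 1 ∧ ‖b + l * a‖ = ‖b‖ + ‖a‖ := by
      refine ⟨Complex.exp ((Complex.arg b - Complex.arg a : ℝ) * Complex.I),
        Complex.norm_exp_ofReal_mul_I _, ?_⟩
      have h1 : b + Complex.exp ((Complex.arg b - Complex.arg a : ℝ) * Complex.I) * a =
          ((‖b‖ + ‖a‖ : ℝ) : ℂ) * Complex.exp (Complex.arg b * Complex.I) := by
        have : Complex.exp (Complex.arg b * Complex.I) =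
          Complex.exp ((Complex.arg b - Complex.arg a : ℝ) * Complex.I) *
            Complex.exp (Complex.arg a * Complex.I) := by
          rw [← Complex.exp_add]; congr 1; push_cast; ring
        push_cast at this ⊢
        linear_combination (‖a‖ : ℂ) * this.symm - Complex.norm_mul_exp_arg_mul_I b -
          Complex.exp (((Complex.arg b : ℂ) - Complex.arg a) * Complex.I) *
            Complex.norm_mul_exp_arg_mul_I a
      rw [h1, norm_mul, Complex.norm_exp_ofReal_mul_I, mul_one, Complex.norm_real,
        Real.norm_of_nonneg (by positivity)]
    have h2 := f.le_opNorm (z + (l - 1) • T z)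
    rw [hf.1, one_mul] at h2
    have h3 : f (z + (l - 1) • T z) = b + l * a := by
      simp only [map_add, map_smul, hf.2, smul_eq_mul, hb, ← ha]; ring
    rw [h3, hlab] at h2
    exact h2.trans (h l hl z)
  have h1 : b.re + a.re = ‖z‖ := by simp [hb]
  have h2 := Complex.re_le_norm b
  have h3 : a.re = ‖a‖ := le_antisymm (Complex.re_le_norm a) (by linarith)
  exact (Complex.nonneg_iff.mp (Complex.re_eq_norm.mp h3)).2.symm

/-- Conjugation by an isometric operator `V` with inverse `W`. -/
lemma conjugate (hS : IsHermitianOperator S) {V W : Z →L[ℂ] Z} (hV : ∀ z, ‖V z‖ = ‖z‖)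
    (hVW : V * W = 1) (hWV : W * V = 1) : IsHermitianOperator (V * S * W) := by
  intro z f hf
  have hVW' : ∀ z, V (W z) = z := fun z => by simpa using congr($hVW z)
  have hWV' : ∀ z, W (V z) = z := fun z => by simpa using congr($hWV z)
  have hW : ∀ z, ‖W z‖ = ‖z‖ := fun z => by rw [← hV, hVW']
  have hnorm : ‖f.comp V‖ = 1 := by
    rw [← hf.1]
    refine le_antisymm (ContinuousLinearMap.opNorm_le_bound _ (norm_nonneg _) fun y => ?_)
      (ContinuousLinearMap.opNorm_le_bound _ (norm_nonneg _) fun y => ?_)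
    · simpa [hV] using f.le_opNorm (V y)
    · simpa [hW, hVW'] using (f.comp V).le_opNorm (W y)
  have := hS (W z) (f.comp V) ⟨hnorm, by simp [hVW', hW, hf.2]⟩
  simpa using this

/-- The conjugate of `S` by the rotation `1 + (l - 1) T`, expanded. -/
lemma conj_rotation (hS : IsHermitianOperator S) (hT : IsHermitianOperator T)
    (hTT : IsIdempotentElem T) {l : ℂ} (hl : ‖l‖ = 1) :
    IsHermitianOperator (S + (l - 1) • (T * S) + (conj l - 1) • (S * T)
      + ((l - 1) * (conj l - 1)) • (T * S * T)) := by
  have hll : l * (starRingEnd ℂ) l = 1 := by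
    rw [Complex.mul_conj, Complex.normSq_eq_norm_sq, hl]; simp
  have hTT' : T * T = T := hTT
  have inv : ∀ a b : ℂ, a * b = 1 → (1 + (a - 1) • T) * (1 + (b - 1) • T) = 1 := fun a b hab => by
    simp only [add_mul, mul_add, one_mul, mul_one, smul_mul_assoc, mul_smul_comm, hTT']
    calc _ = 1 + (a * b - 1) • T := by module
      _ = 1 := by simp [hab]
  have := hS.conjugate (V := 1 + (l - 1) • T) (W := 1 + ((starRingEnd ℂ) l - 1) • T)
    (fun z => by simpa using hT.norm_rotation hTT hl z) (inv _ _ hll)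
    (inv _ _ (by rw [mul_comm, hll]))
  convert this using 1
  simp only [add_mul, mul_add, one_mul, mul_one, smul_mul_assoc, mul_smul_comm]
  module

lemma commutator (hS : IsHermitianOperator S) (hT : IsHermitianOperator T)
    (hTT : IsIdempotentElem T) : IsHermitianOperator (Complex.I • (T * S - S * T)) := by
  have h1 := hS.conj_rotation hT hTT (l := Complex.I) (by simp)
  have h2 := hS.conj_rotation hT hTT (l := -Complex.I) (by simp)
  convert (h1.sub h2).real_smul (1 / 2) using 1
  simp only [Complex.conj_I, map_neg]
  push_cast
  module

lemma anticommutator (hS : IsHermitianOperator S) (hT : IsHermitianOperator T)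
    (hTT : IsIdempotentElem T) :
    IsHermitianOperator (T * S + S * T - (2 : ℂ) • (T * S * T)) := by
  have h1 := hS.conj_rotation hT hTT (l := Complex.I) (by simp)
  have h2 := hS.conj_rotation hT hTT (l := -Complex.I) (by simp)
  convert ((hS.real_smul 2).sub (h1.add h2)).real_smul (1 / 2) using 1
  simp only [Complex.conj_I, map_neg]
  push_cast
  have : (Complex.I - 1) * (-Complex.I - 1) = 2 := by linear_combination -Complex.I_mul_I
  have h' : (-Complex.I - 1) * (- -Complex.I - 1) = 2 := by linear_combination -Complex.I_mul_I
  rw [this, h']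
  module

end IsHermitianOperator

end Operators

/-! ### Rank-one hermitian operators -/

section RankOne

variable {Z : Type*} [NormedAddCommGroup Z] [NormedSpace ℂ Z]

/-- The rank-one operator `z ↦ f z • u` is a hermitian projection onto `span {u}`; the
normalization `f u = 1` makes it idempotent and forces `u ≠ 0`. -/
def IsHermitianPair (f : StrongDual ℂ Z) (u : Z) : Prop :=
  IsHermitianOperator (f.smulRight u) ∧ f u = 1

variable {f g : StrongDual ℂ Z} {u v : Z}

lemma IsHermitianPair.ne_zero (h : IsHermitianPair f u) : u ≠ 0 := by
  rintro rfl
  simpa using h.2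

lemma IsHermitianPair.isIdempotentElem (h : IsHermitianPair f u) :
    IsIdempotentElem (f.smulRight u) := by
  ext z
  simp [h.2]

lemma isHermitianElement_zero : IsHermitianElement (0 : Z) :=
  ⟨0, IsIdempotentElem.zero, by simp, fun z f _ => by simp⟩

lemma IsHermitianElement.exists_pair (hu : IsHermitianElement u) (hu0 : u ≠ 0) :
    ∃ f, IsHermitianPair f u := by
  obtain ⟨Q, hQQ, hQ, hQh⟩ := hu
  obtain ⟨ψ, hψ⟩ := SeparatingDual.exists_eq_one (R := ℂ) hu0
  have hQz : ∀ z, Q z = ψ (Q z) • u := fun z => by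
    have : Q z ∈ Submodule.span ℂ {u} := hQ ▸ LinearMap.mem_range_self (Q : Z →ₗ[ℂ] Z) z
    obtain ⟨c, hc⟩ := Submodule.mem_span_singleton.mp this
    simp [← hc, hψ]
  have hQu : Q u = u := by
    have : u ∈ LinearMap.range (Q : Z →ₗ[ℂ] Z) := hQ ▸ Submodule.mem_span_singleton_self u
    obtain ⟨z, hz⟩ := this
    have hz' : Q z = u := hz
    rw [← hz']
    simpa using congr($hQQ z)
  refine ⟨ψ.comp Q, ?_, by simp [hQu, hψ]⟩
  convert hQh using 1
  ext z
  simp [← hQz]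

lemma IsHermitianPair.isHermitianElement_smul (h : IsHermitianPair f u) (c : ℂ) :
    IsHermitianElement (c • u) := by
  rcases eq_or_ne c 0 with rfl | hc
  · simpa using isHermitianElement_zero
  refine ⟨f.smulRight u, h.isIdempotentElem, ?_, h.1⟩
  rw [Submodule.span_singleton_smul_eq (IsUnit.mk0 c hc)]
  ext z
  rw [Submodule.mem_span_singleton]
  constructor
  · rintro ⟨y, rfl⟩
    exact ⟨f y, by simp⟩
  · rintro ⟨a, rfl⟩
    exact ⟨a • u, by simp [h.2]⟩

/-- The eigenvalue `f u` of a hermitian operator is real. -/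
lemma IsHermitianOperator.im_apply_eq_zero (h : IsHermitianOperator (f.smulRight u)) :
    (f u).im = 0 := by
  by_cases hu : u = 0
  · simp [hu]
  obtain ⟨φ, hφ, hφu⟩ := exists_dual_vector ℂ u (norm_ne_zero_iff.mpr hu)
  have := h u φ ⟨hφ, hφu⟩
  simpa [hφu, hu] using this

/-- Otherwise the operator would be nilpotent. -/
lemma IsHermitianOperator.apply_ne_zero (h : IsHermitianOperator (f.smulRight u))
    (hf : f ≠ 0) (hu : u ≠ 0) : f u ≠ 0 := by
  intro h0
  have := h.eq_zero_of_mul_self_eq_zero (by ext z; simp [h0])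
  refine hf (ContinuousLinearMap.ext fun z => ?_)
  simpa [hu] using congr($this z)

lemma IsHermitianOperator.isHermitianPair (h : IsHermitianOperator (f.smulRight u))
    (hf : f ≠ 0) (hu : u ≠ 0) : IsHermitianPair ((f u)⁻¹ • f) u := by
  refine ⟨?_, by simp [h.apply_ne_zero hf hu]⟩
  have hre : f u = ((f u).re : ℂ) := Complex.ext rfl (by simp [h.im_apply_eq_zero])
  convert h.real_smul (f u).re⁻¹ using 1
  ext z
  rw [hre]
  simp [mul_smul]

/-- The functional of a hermitian projection onto `span {u}` is, up to a factor `‖u‖`, norming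
for `u`, as the projection `T = (1 - (1 - 2T)) / 2` is contractive. -/
lemma IsHermitianPair.im_apply_eq_zero (h : IsHermitianPair f u) {S : Z →L[ℂ] Z}
    (hS : IsHermitianOperator S) : (f (S u)).im = 0 := by
  have hu : 0 < ‖u‖ := norm_pos_iff.mpr h.ne_zero
  have hle : ∀ z, ‖f z‖ * ‖u‖ ≤ ‖z‖ := fun z => by
    have h1 := h.1.norm_rotation h.isIdempotentElem (l := -1) (by simp) z
    have h2 : (2 : ℂ) • f z • u = z - (z + (-1 - 1 : ℂ) • f.smulRight u z) := by
      simp only [ContinuousLinearMap.smulRight_apply]; module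
    have h3 := norm_sub_le z (z + (-1 - 1 : ℂ) • f.smulRight u z)
    rw [← h2, h1, norm_smul, norm_smul] at h3
    norm_num at h3
    linarith
  have hnorm : IsNorming ((‖u‖ : ℂ) • f) u := by
    have hfu : ((‖u‖ : ℂ) • f) u = ‖u‖ := by simp [h.2]
    refine ⟨le_antisymm (ContinuousLinearMap.opNorm_le_bound _ zero_le_one fun z => ?_) ?_, hfu⟩
    · simpa [mul_comm] using hle z
    · have := ((‖u‖ : ℂ) • f).le_opNorm u
      rw [hfu, Complex.norm_real, norm_norm] at this
      exact (le_mul_iff_one_le_left hu).mp this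
  simpa [hu.ne'] using hS u _ hnorm

lemma IsHermitianPair.im_mul_eq_zero (hf : IsHermitianPair f u) (hg : IsHermitianPair g v) :
    (f v * g u).im = 0 := by
  simpa [mul_comm] using hf.im_apply_eq_zero hg.1

/-- If `f v = 0`, then the commutator of the two projections is nilpotent, hence zero. -/
lemma IsHermitianPair.apply_ne_zero_symm (hf : IsHermitianPair f u) (hg : IsHermitianPair g v)
    (h : f v ≠ 0) : g u ≠ 0 := by
  intro h0
  have hc := hg.1.commutator hf.1 hf.isIdempotentElem
  have := hc.eq_zero_of_mul_self_eq_zero (by ext z; simp [h0])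
  have h2 := congr($this v)
  simp [h0, hg.2, h, hf.ne_zero] at h2

/-- Two hermitian projections `f ⊗ u` and `g ⊗ v` with `f v ≠ 0` behave as orthogonal projections
for an inner product with `⟪u, ·⟫ = f` and `⟪v, ·⟫ = κ g`: the rank-one operator attached to any
combination of `u` and `v` is hermitian. It is a real combination of `f ⊗ u`, `g ⊗ v`, their
commutator times `i` and their symmetrized product. -/
lemma IsHermitianPair.exists_isHermitianOperator_combination (hf : IsHermitianPair f u)
    (hg : IsHermitianPair g v) (h : f v ≠ 0) :
    ∃ κ : ℝ, κ ≠ 0 ∧ ∀ a b : ℂ, IsHermitianOperator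
      ((conj a • f + (conj b * κ) • g).smulRight (a • u + b • v)) := by
  have hq := hf.apply_ne_zero_symm hg h
  set p := f v
  set q := g u
  have hc : ((p * q).re : ℂ) = p * q :=
    Complex.ext rfl (by simpa using (hf.im_mul_eq_zero hg).symm)
  have hc0 : ((p * q).re : ℂ) ≠ 0 := hc ▸ mul_ne_zero h hq
  refine ⟨Complex.normSq p / (p * q).re, ?_, fun a b => ?_⟩
  · exact div_ne_zero (by simpa using h) (by exact_mod_cast hc0)
  have hκ : ((Complex.normSq p / (p * q).re : ℝ) : ℂ) * q = conj p := by
    push_cast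
    rw [hc, Complex.normSq_eq_conj_mul_self]
    field_simp
  set κ : ℝ := Complex.normSq p / (p * q).re 
  intro z φ hφ
  have hA := (hg.1.commutator hf.1 hf.isIdempotentElem) z φ hφ
  have hB := (hg.1.anticommutator hf.1 hf.isIdempotentElem) z φ hφ
  have hfu := hf.1 z φ hφ
  have hgv := hg.1 z φ hφ
  have hA' : (p * g z * φ u).re = (q * f z * φ v).re := by
    have : φ ((Complex.I • (f.smulRight u * g.smulRight v - g.smulRight v * f.smulRight u)) z) =
        Complex.I * (p * g z * φ u - q * f z * φ v) := by
      simp only [p, q, smul_apply, sub_apply, mul_apply_eq_comp,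
        ContinuousLinearMap.smulRight_apply, map_smul, map_sub, smul_eq_mul]
      ring
    rw [this, Complex.I_mul_im, Complex.sub_re] at hA
    linarith
  have hB' : (p * g z * φ u).im + (q * f z * φ v).im = 0 := by
    have : φ ((f.smulRight u * g.smulRight v + g.smulRight v * f.smulRight u -
          (2 : ℂ) • (f.smulRight u * g.smulRight v * f.smulRight u)) z) =
        p * g z * φ u + q * f z * φ v - ((2 * (p * q).re : ℝ) : ℂ) * (f z * φ u) := by
      rw [Complex.ofReal_mul, hc, Complex.ofReal_ofNat]
      simp only [p, q, smul_apply, sub_apply, add_apply, mul_apply_eq_comp,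
        ContinuousLinearMap.smulRight_apply, map_smul, map_sub, map_add, smul_eq_mul]
      ring
    have hfu' : (f z * φ u).im = 0 := by simpa using hfu
    rw [this, Complex.sub_im, Complex.add_im, Complex.im_ofReal_mul, hfu'] at hB
    linarith
  -- `q * f z * φ v` is the complex conjugate of `p * g z * φ u`.
  have hconj : conj p * conj (g z * φ u) = q * (f z * φ v) := by
    rw [← map_mul, ← mul_assoc, ← mul_assoc]
    exact Complex.ext (by rw [Complex.conj_re]; exact hA') (by rw [Complex.conj_im]; linarith)
  have hconj' : f z * φ v = κ * conj (g z * φ u) :=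
    mul_left_cancel₀ hq (by rw [← hconj, ← hκ]; ring)
  have hexp : φ (((conj a • f + (conj b * κ) • g).smulRight (a • u + b • v)) z) =
      (Complex.normSq a : ℂ) * (f z * φ u) + ((κ * Complex.normSq b : ℝ) : ℂ) * (g z * φ v) +
        κ * (a * conj b * (g z * φ u) + conj (a * conj b * (g z * φ u))) := by
    rw [map_mul, map_mul, Complex.conj_conj]
    push_cast
    rw [Complex.normSq_eq_conj_mul_self, Complex.normSq_eq_conj_mul_self]
    simp only [smul_apply, add_apply, ContinuousLinearMap.smulRight_apply, map_smul, map_add,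
      smul_eq_mul]
    linear_combination conj a * b * hconj'
  have hfu' : (f z * φ u).im = 0 := by simpa using hfu
  have hgv' : (g z * φ v).im = 0 := by simpa using hgv
  rw [hexp, Complex.add_conj, ← Complex.ofReal_mul, Complex.add_im, Complex.add_im,
    Complex.im_ofReal_mul, Complex.im_ofReal_mul, Complex.ofReal_im, hfu', hgv']
  simp

end RankOne

/-! ### Hilbert components -/

section Components

variable {Z : Type*} [NormedAddCommGroup Z] [NormedSpace ℂ Z]
variable {f g : StrongDual ℂ Z} {u v : Z}

/-- The span of two non-orthogonal hermitian elements consists of hermitian elements. -/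
lemma IsHermitianPair.isHermitianElement_combination (hf : IsHermitianPair f u)
    (hg : IsHermitianPair g v) (h : f v ≠ 0) (a b : ℂ) : IsHermitianElement (a • u + b • v) := by
  obtain ⟨κ, hκ, hcomb⟩ := hf.exists_isHermitianOperator_combination hg h
  by_cases hw : a • u + b • v = 0
  · rw [hw]; exact isHermitianElement_zero
  by_cases hF : conj a • f + (conj b * κ) • g = 0
  · -- If the functional attached to `a • u + b • v` degenerates, `f` and `g` are proportional and
    -- hence so are `u` and `v`.
    have hb : b ≠ 0 := by
      rintro rfl
      have ha : a ≠ 0 := by rintro rfl; simp at hw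
      have := congr($hF u)
      simp [hf.2, ha] at this
    have hbκ : conj b * (κ : ℂ) ≠ 0 := by simp [hb, hκ]
    obtain ⟨c, rfl⟩ : ∃ c : ℂ, g = c • f := by
      refine ⟨-(conj b * κ)⁻¹ * conj a, ContinuousLinearMap.ext fun z => ?_⟩
      have := congr($hF z)
      simp only [add_apply, smul_apply, smul_eq_mul, zero_apply] at this ⊢
      refine mul_left_cancel₀ hbκ ?_
      linear_combination this + conj a * f z * mul_inv_cancel₀ hbκ
    have hcv : c * f v = 1 := hg.2
    have hnil : (f.smulRight u - (c • f).smulRight v) = 0 := by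
      refine (hf.1.sub hg.1).eq_zero_of_mul_self_eq_zero ?_
      ext z
      simp only [mul_apply_eq_comp, sub_apply, smul_apply,
        ContinuousLinearMap.smulRight_apply, map_sub, map_smul, smul_eq_mul, hf.2, zero_apply]
      have : (c * f z) • f v • u = f z • u := by
        rw [smul_smul]
        congr 1
        linear_combination f z * hcv
      rw [smul_sub (c * f z), this, hcv]
      module
    have hu : u = c • v := by
      have := congr($hnil u)
      simpa [hf.2, sub_eq_zero] using this
    rw [hu, smul_smul, ← add_smul]
    exact hg.isHermitianElement_smul _
  · simpa using ((hcomb a b).isHermitianPair hF hw).isHermitianElement_smul 1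

/-- A hermitian element that is not orthogonal to some element of a subspace of hermitian elements
can be adjoined to that subspace. -/
lemma IsHermitianPair.isHermitianElement_add_smul {S : Submodule ℂ Z}
    (hS : ∀ s ∈ S, IsHermitianElement s) (hf : IsHermitianPair f u) {x : Z} (hx : x ∈ S)
    (hfx : f x ≠ 0) {s : Z} (hs : s ∈ S) (c : ℂ) : IsHermitianElement (s + c • u) := by
  by_cases hfs : f s = 0
  swap
  · have hs0 : s ≠ 0 := by rintro rfl; simp at hfs
    obtain ⟨k, hk⟩ := (hS s hs).exists_pair hs0
    simpa [add_comm] using hf.isHermitianElement_combination hk hfs c 1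
  -- When `f s = 0`, write `s + c • u = (s + ε • x) + (c • u - ε • x)`, where `ε` is chosen such
  -- that the two summands are not orthogonal.
  have hx0 : x ≠ 0 := by rintro rfl; simp at hfx
  obtain ⟨g, hg⟩ := (hS x hx).exists_pair hx0
  obtain ⟨κ, hκ, hcomb⟩ := hf.exists_isHermitianOperator_combination hg hfx
  have hκ' : (κ : ℂ) ≠ 0 := by exact_mod_cast hκ
  obtain ⟨ε, hε0, hε⟩ : ∃ ε : ℝ, ε ≠ 0 ∧ conj c * f x - κ * (g s + ε) ≠ 0 := by
    by_cases h1 : conj c * f x - κ * (g s + 1) = 0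
    · refine ⟨2, two_ne_zero, fun h2 => hκ' ?_⟩
      push_cast at h2
      linear_combination h1 - h2
    · exact ⟨1, one_ne_zero, by simpa using h1⟩
  have hε0' : (ε : ℂ) ≠ 0 := by exact_mod_cast hε0
  set y := s + (ε : ℂ) • x with hy
  have hyS : y ∈ S := S.add_mem hs (S.smul_mem _ hx)
  set w := c • u + (-ε : ℂ) • x with hw
  have hsum : s + c • u = y + w := by rw [hy, hw]; module
  by_cases hw0 : w = 0
  · rw [hsum, hw0, add_zero]
    exact hS y hyS
  have hval : (conj c • f + (conj (-ε : ℂ) * κ) • g) y ≠ 0 := by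
    have : (conj c • f + (conj (-ε : ℂ) * κ) • g) y =
        ε * (conj c * f x - κ * (g s + ε)) := by
      simp only [hy, add_apply, smul_apply, map_add, map_smul, smul_eq_mul, hfs, hg.2, map_neg,
        Complex.conj_ofReal]
      ring
    rw [this]
    exact mul_ne_zero hε0' hε
  have hF : conj c • f + (conj (-ε : ℂ) * κ) • g ≠ 0 := by
    intro h0
    exact hval (by rw [h0]; simp)
  have hop := hcomb c (-ε)
  have hpair := hop.isHermitianPair hF hw0
  have hy0 : y ≠ 0 := by
    intro h0
    exact hval (by rw [h0, map_zero])
  obtain ⟨k, hk⟩ := (hS y hyS).exists_pair hy0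
  have hne := hop.apply_ne_zero hF hw0
  have := hpair.isHermitianElement_combination hk
    (by rw [smul_apply, smul_eq_mul]; exact mul_ne_zero (inv_ne_zero hne) hval) 1 1
  rw [one_smul, one_smul] at this
  rw [hsum, add_comm]
  exact this

lemma IsHilbertComponent.mem_of_apply_ne_zero {H : Submodule ℂ Z} (hH : IsHilbertComponent H)
    (hf : IsHermitianPair f u) {x : Z} (hx : x ∈ H) (hfx : f x ≠ 0) : u ∈ H := by
  refine hH.2 (y := H ⊔ Submodule.span ℂ {u}) (fun z hz => ?_) le_sup_left
    (Submodule.mem_sup_right (Submodule.mem_span_singleton_self u))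
  obtain ⟨s, hs, t, ht, rfl⟩ := Submodule.mem_sup.mp hz
  obtain ⟨c, rfl⟩ := Submodule.mem_span_singleton.mp ht
  exact hf.isHermitianElement_add_smul hH.1 hx hfx hs c

/-- Distinct Hilbert components intersect trivially. -/
lemma IsHilbertComponent.eq_of_mem {H K : Submodule ℂ Z} (hH : IsHilbertComponent H)
    (hK : IsHilbertComponent K) (huH : u ∈ H) (huK : u ∈ K) (hu : u ≠ 0) : H = K := by
  obtain ⟨f, hf⟩ := (hH.1 u huH).exists_pair hu
  have main : ∀ w ∈ K, f w ≠ 0 → w ∈ H := fun w hw hfw => by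
    have hw0 : w ≠ 0 := by rintro rfl; simp at hfw
    obtain ⟨g, hg⟩ := (hK.1 w hw).exists_pair hw0
    exact hH.mem_of_apply_ne_zero hg huH (hf.apply_ne_zero_symm hg hfw)
  have hKH : K ≤ H := fun w hw => by
    by_cases hfw : f w = 0
    · have : w + u ∈ H := main _ (K.add_mem hw huK) (by simp [hfw, hf.2])
      simpa using H.sub_mem this huH
    · exact main w hw hfw
  exact le_antisymm (hK.2 hH.1 hKH) hKH

end Components

/-! ### Unconditional bases and norm one projections -/

section Basis

variable {I : Type*} {X : Type*} [NormedAddCommGroup X] [NormedSpace ℂ X]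
variable {e : UnconditionalSchauderBasis I ℂ X}

lemma coord_eq_of_hasSum {a : I → ℂ} {x : X} (h : HasSum (fun i => a i • e i) x) (i : I) :
    e.coord i x = a i := by
  classical
  have h1 := (e.coord i).hasSum h
  refine h1.unique ?_
  convert! hasSum_ite_eq i (a i) using 2 with j
  by_cases hj : j = i
  · subst hj; simp [e.ortho]
  · simp [e.ortho, hj, Ne.symm hj]

/-- Multiplying the coordinates of a vector by numbers of modulus one gives again a vector of the
same norm. -/
lemma IsOneUnconditional.exists_coord_mul [CompleteSpace X] (he : IsOneUnconditional e)
    {θ : I → ℂ} (hθ : ∀ i, ‖θ i‖ = 1) (x : X) :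
    ∃ y : X, (∀ i, e.coord i y = θ i * e.coord i x) ∧ ‖y‖ = ‖x‖ := by
  have hs : Summable fun i => (θ i * e.coord i x) • e i := by
    have := summable_iff_vanishing_norm.mp (e.expansion x).summable
    rw [summable_iff_vanishing_norm]
    intro ε hε
    obtain ⟨s, hs⟩ := this ε hε
    exact ⟨s, fun t ht => by rw [he t _ θ fun i _ => hθ i]; exact hs t ht⟩
  obtain ⟨y, hy⟩ := hs
  refine ⟨y, coord_eq_of_hasSum hy, ?_⟩
  refine tendsto_nhds_unique (Tendsto.norm hy) ?_
  convert! Tendsto.norm (e.expansion x) using 2 with s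
  exact he s _ θ fun i _ => hθ i

lemma ext_coord {x y : X} (h : ∀ i, e.coord i x = e.coord i y) : x = y := by
  refine (e.expansion x).unique ?_
  simpa only [h] using e.expansion y

lemma IsOneUnconditional.norm_eq [CompleteSpace X] (he : IsOneUnconditional e) {x y : X}
    (h : ∀ i, ‖e.coord i x‖ = ‖e.coord i y‖) : ‖x‖ = ‖y‖ := by
  have : ∀ i, ∃ θ : ℂ, ‖θ‖ = 1 ∧ e.coord i x = θ * e.coord i y := fun i => by
    by_cases hy : e.coord i y = 0
    · exact ⟨1, by simp, by simpa [hy] using h i⟩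
    · refine ⟨e.coord i x / e.coord i y, ?_, (div_mul_cancel₀ _ hy).symm⟩
      rw [norm_div, h, div_self (norm_ne_zero_iff.mpr hy)]
  choose θ hθ hxy using this
  obtain ⟨z, hz, hzn⟩ := he.exists_coord_mul hθ y
  rw [← hzn, ext_coord (fun i => (hxy i).trans (hz i).symm)]

lemma IsOneUnconditional.isHermitianOperator_coord [CompleteSpace X] (he : IsOneUnconditional e)
    (i : I) : IsHermitianOperator ((e.coord i).smulRight (e i)) := by
  classical
  refine .of_norm_rotation_le fun l hl x => (he.norm_eq fun j => ?_).le
  by_cases hj : j = i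
  · subst hj
    simp [e.ortho, sub_mul, hl]
  · simp [e.ortho, hj]

/-- Deleting a nonzero coordinate strictly decreases the norm. -/
lemma IsStrictlyMonotone.norm_sub_coord_lt [CompleteSpace X] (hm : IsStrictlyMonotone e)
    (he : IsOneUnconditional e) {x : X} {i : I} (hi : e.coord i x ≠ 0) :
    ‖x - e.coord i x • e i‖ < ‖x‖ := by
  classical
  -- The modulus of the vector with its `i`-th coordinate deleted.
  obtain ⟨y, hy⟩ : ∃ y : X, ∀ j, e.coord j y = ‖e.coord j (x - e.coord i x • e i)‖ := by
    have hθ : ∀ j, ∃ θ : ℂ, ‖θ‖ = 1 ∧ θ * e.coord j (x - e.coord i x • e i) =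
        ‖e.coord j (x - e.coord i x • e i)‖ := fun j => by
      set c := e.coord j (x - e.coord i x • e i)
      by_cases hc : c = 0
      · exact ⟨1, by simp, by simp [hc]⟩
      · exact ⟨‖c‖ / c, by simp [hc], div_mul_cancel₀ _ hc⟩
    choose θ hθ hθc using hθ
    obtain ⟨y, hy, -⟩ := he.exists_coord_mul hθ (x - e.coord i x • e i)
    exact ⟨y, fun j => (hy j).trans (hθc j)⟩
  have hcoord : ∀ j, e.coord j (x - e.coord i x • e i) = if j = i then 0 else e.coord j x := by
    intro j
    by_cases hj : j = i
    · subst hj; simp [e.ortho]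
    · simp [e.ortho, hj]
  have hcoord' : ∀ j, e.coord j ((‖e.coord i x‖ : ℂ) • e i) =
      if j = i then (‖e.coord i x‖ : ℂ) else 0 := by
    intro j
    by_cases hj : j = i
    · subst hj; simp [e.ortho]
    · simp [e.ortho, hj]
  have h1 : ‖y‖ = ‖x - e.coord i x • e i‖ := he.norm_eq fun j => by simp [hy]
  have h2 : ‖y + (‖e.coord i x‖ : ℂ) • e i‖ = ‖x‖ := he.norm_eq fun j => by
    rw [map_add, hy, hcoord, hcoord']
    by_cases hj : j = i
    · subst hj; simp
    · simp [hj]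
  rw [← h1, ← h2]
  refine hm _ _ (fun j => by simp [hy]) (fun j => ?_) fun h0 => ?_
  · rw [hcoord']
    split_ifs <;> simp
  · have := hcoord' i
    rw [h0, map_zero, if_pos rfl] at this
    exact hi (by simpa using this.symm)

/-- The compression of a hermitian operator to the range of a norm one projection `P` is hermitian,
because `φ ∘ P` is norming in `X` for every `φ` norming in the range of `P`. -/
lemma IsHermitianOperator.compression {P : X →L[ℂ] X} (hP : IsIdempotentElem P) (hP1 : ‖P‖ = 1)
    {T : X →L[ℂ] X} (hT : IsHermitianOperator T) :
    IsHermitianOperator (((P.codRestrict (LinearMap.range (P : X →ₗ[ℂ] X))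
      (fun x => LinearMap.mem_range_self (P : X →ₗ[ℂ] X) x)).comp T).comp
        (LinearMap.range (P : X →ₗ[ℂ] X)).subtypeL) := by
  intro y φ hφ
  set R := P.codRestrict (LinearMap.range (P : X →ₗ[ℂ] X))
      (fun x => LinearMap.mem_range_self (P : X →ₗ[ℂ] X) x)
  have hR : ∀ y : LinearMap.range (P : X →ₗ[ℂ] X), R (y : X) = y := by
    rintro ⟨_, x, rfl⟩
    exact Subtype.ext congr($hP x)
  have hnorm : ‖φ.comp R‖ = 1 := by
    refine le_antisymm (ContinuousLinearMap.opNorm_le_bound _ zero_le_one fun x => ?_) ?_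
    · have h1 := φ.le_opNorm (R x)
      have h2 := P.le_opNorm x
      rw [hφ.1, one_mul] at h1
      rw [hP1] at h2
      exact h1.trans h2
    · rw [← hφ.1]
      refine ContinuousLinearMap.opNorm_le_bound _ (norm_nonneg _) fun y => ?_
      simpa [hR] using (φ.comp R).le_opNorm (y : X)
  simpa using hT y (φ.comp R) ⟨hnorm, by simp [hR, hφ.2]⟩

/-- If `i` belongs to the support of an element `x` of the range of a norm one projection `P`, then
`P (e i)` is a hermitian element of the range, with functional a multiple of the `i`-th
coordinate. -/
lemma exists_isHermitianPair_coord [CompleteSpace X] (he : IsOneUnconditional e)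
    (hm : IsStrictlyMonotone e) {P : X →L[ℂ] X} (hP : IsIdempotentElem P) (hP1 : ‖P‖ = 1) {i : I}
    {x : LinearMap.range (P : X →ₗ[ℂ] X)} (hx : i ∈ supp e (x : X)) :
    ∃ (f : StrongDual ℂ (LinearMap.range (P : X →ₗ[ℂ] X)))
      (u : LinearMap.range (P : X →ₗ[ℂ] X)), IsHermitianPair f u ∧
        ∀ y : LinearMap.range (P : X →ₗ[ℂ] X), i ∈ supp e (y : X) → f y ≠ 0 := by
  set f := (e.coord i).comp (LinearMap.range (P : X →ₗ[ℂ] X)).subtypeL with hf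
  set u : LinearMap.range (P : X →ₗ[ℂ] X) :=
    ⟨P (e i), LinearMap.mem_range_self (P : X →ₗ[ℂ] X) (e i)⟩ with hu
  have hxi : e.coord i (x : X) ≠ 0 := hx
  have hf0 : f ≠ 0 := fun h => hxi (by simpa [hf] using congr($h x))
  have hPx : P (x : X) = x := by
    obtain ⟨_, z, rfl⟩ := x
    exact congr($hP z)
  have hu0 : u ≠ 0 := by
    intro h
    have hPe : P (e i) = 0 := congrArg Subtype.val h
    have h1 : P (x - e.coord i (x : X) • e i) = x := by simp [hPe, hPx]
    have h2 := P.le_opNorm (x - e.coord i (x : X) • e i)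
    rw [h1, hP1, one_mul] at h2
    exact absurd (hm.norm_sub_coord_lt he hxi) (not_lt.mpr h2)
  have hop : IsHermitianOperator (f.smulRight u) := by
    convert (he.isHermitianOperator_coord i).compression hP hP1 using 1
    ext y
    change e.coord i y • P (e i) = P (e.coord i y • e i)
    rw [map_smul]
  refine ⟨_, u, hop.isHermitianPair hf0 hu0, fun y hy => ?_⟩
  rw [smul_apply, smul_eq_mul]
  exact mul_ne_zero (inv_ne_zero (hop.apply_ne_zero hf0 hu0)) hy

end Basis

end BanachSeq

theorem theorem3p1 {I : Type*} [Countable I]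
    {X : Type*} [NormedAddCommGroup X] [NormedSpace ℂ X] [CompleteSpace X]
    (e : UnconditionalSchauderBasis I ℂ X)
    (he : BanachSeq.IsOneUnconditional e)
    (hmono : BanachSeq.IsStrictlyMonotone e)
    (hX : IsEmpty (X ≃ₗᵢ[ℂ] lp (fun _ : ℕ => ℂ) 2))
    (P : X →L[ℂ] X) (hP : IsIdempotentElem P) (hP1 : ‖P‖ = 1)
    (H K : Submodule ℂ (LinearMap.range (P : X →ₗ[ℂ] X)))
    (hH : BanachSeq.IsHilbertComponent H) (hK : BanachSeq.IsHilbertComponent K)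
    (hHK : H ≠ K) :
    ∀ x ∈ H, ∀ y ∈ K, Disjoint (BanachSeq.supp e (x : X)) (BanachSeq.supp e (y : X)) := by
  intro x hx y hy
  rw [Set.disjoint_left]
  intro i hix hiy
  obtain ⟨f, u, hf, hne⟩ := BanachSeq.exists_isHermitianPair_coord he hmono hP hP1 hix
  exact hHK (hH.eq_of_mem hK (hH.mem_of_apply_ne_zero hf hx (hne x hix))
    (hK.mem_of_apply_ne_zero hf hy (hne y hiy)) hf.ne_zero)
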